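/- **Setting.** Let $\mathcal X$ be a measurable space and $n,k\ge 1$ integers. A linear query is a measurable $q:\mathcal X\to[0,1]$; for a dataset $S\in\mathcal X^n$ put $q(S)=\frac1n\sum_{i=1}^n q(S_i)$, and for a probability distribution $\mathcal P$ on $\mathcal X$ put $q(\mathcal P^n)=\mathbb E_{S\sim\mathcal P^n}[q(S)]$. Queries are taken from a family $Q$ that is indexed by a measurable space and for which $(q,x)\mapsto q(x)$ is jointly measurable. A randomized analyst $\mathcal A$ interacts for $k$ rounds with a mechanism $M$ holding $S$: in round $j$ the analyst chooses a query $q_j\in Q$ at random, depending on the transcript of the previous rounds, and receives an answer $a_j\in\mathbb R$. The Gaussian mechanism with parameter $\sigma>0$ draws $a_j\sim\mathcal N(q_j(S),\sigma^2)$, with fresh independent noise in each round. $M$ is $(\alpha,\beta)$-distributionally accurate (for $k$ queries) if for every analyst $\mathcal A$ and every probability distribution $\mathcal P$ on $\mathcal X$, when $S\sim\mathcal P^n$ and $\mathcal A$ interacts with $M$ on $S$, $$\Pr\Big[\max_{1\le j\le k}|q_j(\mathcal P^n)-a_j|\ge\alpha\Big]\le\beta .$$ Let $\mathrm{erfc}(x)=1-\frac{2}{\sqrt\pi}\int_0^x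 e^{-t^2}\,dt$, a decreasing bijection $\mathbb R\to(0,2)$ with inverse $\mathrm{erfc}^{-1}$, let $\log^+=\max(\log,0)$, and for $\sigma,\delta>0$ put $\rho=\frac{k}{2n^2\sigma^2}$ and $$\varepsilon(\sigma,\delta)=\rho+\sqrt{\frac{2k}{n^2\sigma^2}\,\log^+\!\Big(\frac{\sqrt{\pi\rho}}{\delta}\Big)},\qquad F(\sigma,\delta)=\sqrt2\,\sigma\,\mathrm{erfc}^{-1}\!\Big(\frac{\delta}{k}\Big)+e^{\varepsilon(\sigma,\delta)}-1+\frac{6\delta}{\beta}.$$ **Theorem (distributional accuracy of the Gaussian mechanism).** Let $0<\beta<1$. The minimum $$\alpha=\min_{\sigma>0,\;0<\delta\le\beta}F(\sigma,\delta)$$ exists, and for every minimizer $(\sigma,\delta)$ the Gaussian mechanism with parameter $\sigma$ answers $k$ adaptively chosen linear queries with $(\alpha,\beta)$-distributional accuracy. Moreover, if $\alpha\le 6$, then $\alpha$ is also the minimum of $F(\sigma,\delta)$ over all $\sigma>0$ and $0<\delta\le k$. -/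

import Mathlib

open MeasureTheory ProbabilityTheory

noncomputable section

namespace AdaptiveData

/-- A family of linear queries on the data domain `X`, indexed by the measurable space `Q`: the
index `q` names the query `x ↦ eval q x`, a function with values in `[0, 1]`. The evaluation map
is jointly measurable. -/
structure LinearQueryFamily (X Q : Type*) [MeasurableSpace X] [MeasurableSpace Q] where
  eval : Q → X → ℝ
  measurable_eval : Measurable (Function.uncurry eval)
  eval_mem : ∀ q x, eval q x ∈ Set.Icc (0 : ℝ) 1

section Interaction

variable {X Q : Type*} [MeasurableSpace X] [MeasurableSpace Q] {n : ℕ}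

/-- The empirical average `q(S) = (1/n) ∑ i, q(S_i)`. -/
def LinearQueryFamily.empirical (L : LinearQueryFamily X Q) (q : Q) (S : Fin n → X) : ℝ :=
  (1 / (n : ℝ)) * ∑ i, L.eval q (S i)

/-- `q(D) = E_{S ∼ D} q(S)`, for a distribution `D` on datasets of size `n`. -/
def LinearQueryFamily.expectation (L : LinearQueryFamily X Q) (q : Q)
    (D : Measure (Fin n → X)) : ℝ :=
  ∫ S, L.empirical q S ∂D

/-- Transcripts of `t` rounds: the pairs (query, answer) of the rounds, in order. -/
abbrev Transcript (Q : Type*) (t : ℕ) : Type _ := Fin t → Q × ℝ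

/-- A randomized analyst: the law of the next query, given the transcript so far. -/
structure Analyst (Q : Type*) [MeasurableSpace Q] where
  next : ∀ t : ℕ, Kernel (Transcript Q t) Q
  markov : ∀ t, IsMarkovKernel (next t)

/-- A (stateful, randomized) statistical estimator on datasets of size `n`: the law of the answer
given the dataset, the transcript of the previous rounds and the current query. -/
structure Estimator (X Q : Type*) [MeasurableSpace X] [MeasurableSpace Q] (n : ℕ) where
  answer : ∀ t : ℕ, Kernel ((Fin n → X) × (Transcript Q t × Q)) ℝ
  markov : ∀ t, IsMarkovKernel (answer t)

/-- The law of the transcript of the first `t` rounds of the interaction, as a function of the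
dataset. In each round the analyst draws a query given the transcript so far, and the estimator
draws an answer to it. -/
def interact (M : Estimator X Q n) (A : Analyst Q) :
    ∀ t : ℕ, Kernel (Fin n → X) (Transcript Q t)
  | 0 => Kernel.const _ (Measure.dirac Fin.elim0)
  | t + 1 =>
      ((interact M A t ⊗ₖ (A.next t).comap Prod.snd measurable_snd) ⊗ₖ M.answer t).map
        (fun p : (Transcript Q t × Q) × ℝ =>
          (Fin.snoc p.1.1 (p.1.2, p.2) : Transcript Q (t + 1)))

theorem measurable_transcript_snoc (t : ℕ) :
    Measurable (fun p : (Transcript Q t × Q) × ℝ =>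
      (Fin.snoc p.1.1 (p.1.2, p.2) : Transcript Q (t + 1))) := by
  refine measurable_pi_iff.2 fun i => ?_
  refine Fin.lastCases ?_ (fun j => ?_) i
  · simp only [Fin.snoc_last]
    fun_prop
  · simp only [Fin.snoc_castSucc]
    fun_prop

instance isMarkovKernel_interact (M : Estimator X Q n) (A : Analyst Q) (t : ℕ) :
    IsMarkovKernel (interact M A t) := by
  induction t with
  | zero => unfold interact; infer_instance
  | succ t ih =>
    have := A.markov t
    have := M.markov t
    unfold interact
    exact Kernel.IsMarkovKernel.map _ (measurable_transcript_snoc t)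

/-- The joint law of `(S, Π)`, where `S ∼ P^n` and `Π ∼ Interact(M, A; S)` has `k` rounds. -/
def jointLaw (M : Estimator X Q n) (A : Analyst Q) (P : Measure X) (k : ℕ) :
    Measure ((Fin n → X) × Transcript Q k) :=
  (Measure.pi fun _ : Fin n => P) ⊗ₘ interact M A k

/-- `(α, β)`-distributional accuracy over `k` rounds: for every analyst and every data
distribution `P`, `Pr[max_j |q_j(P^n) - a_j| ≥ α] ≤ β`. -/
def DistributionallyAccurate (L : LinearQueryFamily X Q) (M : Estimator X Q n) (k : ℕ)
    (α β : ℝ) : Prop :=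
  ∀ (A : Analyst Q) (P : Measure X), IsProbabilityMeasure P →
    jointLaw M A P k
      {ω | ∃ j : Fin k,
        α ≤ |L.expectation (ω.2 j).1 (Measure.pi fun _ : Fin n => P) - (ω.2 j).2|}
      ≤ ENNReal.ofReal β

theorem LinearQueryFamily.measurable_empirical (L : LinearQueryFamily X Q) :
    Measurable (fun p : Q × (Fin n → X) => L.empirical p.1 p.2) := by
  unfold LinearQueryFamily.empirical
  refine Measurable.const_mul (Finset.measurable_sum _ fun i _ => ?_) _
  exact L.measurable_eval.comp
    (measurable_fst.prodMk ((measurable_pi_apply i).comp measurable_snd))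

/-- The Gaussian mechanism: the answer to the query `q` on the dataset `S` has the law
`N(q(S), σ²)`, independently of the past. -/
def gaussianMechanism (L : LinearQueryFamily X Q) (n : ℕ) (σ : ℝ) : Estimator X Q n where
  answer t :=
    { toFun := fun p => gaussianReal (L.empirical p.2.2 p.1) (Real.toNNReal (σ ^ 2))
      measurable' := by
        have h : Measurable (fun p : (Fin n → X) × (Transcript Q t × Q) =>
            (L.empirical p.2.2 p.1, Real.toNNReal (σ ^ 2))) :=
          (L.measurable_empirical.comp
            ((measurable_snd.comp measurable_snd).prodMk measurable_fst)).prodMk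
            measurable_const
        exact measurable_gaussianReal.comp h }
  markov t := ⟨fun p => instIsProbabilityMeasureGaussianReal
    (L.empirical p.2.2 p.1) (Real.toNNReal (σ ^ 2))⟩

end Interaction

/-- The complementary error function `erfc x = 1 - erf x`,
`erf x = (2 / √π) ∫_0^x exp(-t²) dt`. -/
def erfc (x : ℝ) : ℝ := 1 - 2 / √Real.pi * ∫ t in (0 : ℝ)..x, Real.exp (-t ^ 2)

/-- The inverse of `erfc`, which is a decreasing bijection from `ℝ` onto `(0, 2)`. -/
def erfcInv : ℝ → ℝ := Function.invFun erfc

/-- The zCDP parameter `ρ = k / (2 n² σ²)` of the Gaussian mechanism on `k` queries. -/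
def rho (k n : ℕ) (σ : ℝ) : ℝ := k / (2 * (n : ℝ) ^ 2 * σ ^ 2)

/-- `ε(σ, δ) = ρ + √(2 (k / (n² σ²)) log (√(π ρ) / δ))`, where the logarithm is replaced by its
positive part, so that the square root is real for all `σ` and `δ`. -/
def privacyEps (k n : ℕ) (σ δ : ℝ) : ℝ :=
  rho k n σ + √(2 * (k / ((n : ℝ) ^ 2 * σ ^ 2)) *
    max (Real.log (√(Real.pi * rho k n σ) / δ)) 0)

/-- The objective `√2 σ erfc⁻¹(δ / k) + exp (ε(σ, δ)) - 1 + 6 (δ / β)`. -/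
def objective (k n : ℕ) (β σ δ : ℝ) : ℝ :=
  √2 * σ * erfcInv (δ / k) + Real.exp (privacyEps k n σ δ) - 1 + 6 * (δ / β)

/-- The values of the objective at the points with `σ > 0` and `0 < δ ≤ D`. -/
def objectiveValues (k n : ℕ) (β D : ℝ) : Set ℝ :=
  {a | ∃ σ δ : ℝ, 0 < σ ∧ 0 < δ ∧ δ ≤ D ∧ a = objective k n β σ δ}

end AdaptiveData

end

namespace AdaptiveData

/-! Accuracy on the sample is a Gaussian tail bound; passing from the sample to the population is
the stability argument "differential privacy implies generalization".

Privacy. The log-likelihood ratio of a transcript for neighbouring datasets is a sum of Gaussian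
ratios, and its exponential moments are bounded round by round, whatever the analyst does
(`lintegral_interact_exp_mul_transcriptLoss_le`). A Chernoff bound followed by integration of the
tail turns these moments into `(ε, δ)`-privacy (`lintegral_one_sub_exp_le`,
`lintegral_interact_gaussianMechanism_le`).

Generalization. From the transcript, select a round whose population error is at least `a + w`, and
replace its query `q` by `1 - q` where the sign of the error demands it. On the bad event `E` the
selected query has sample mean larger than population mean by more than `w`, unless some answer
misses its sample value by at least `a`. But by privacy a query selected from the transcript has
expected sample mean at most `exp ε` times its expected population mean, plus `δ`. With the query
set to `0` off `E`, comparing the two gives `sub_mul_measureReal_populationError_le`. Taking `a` so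
that the sample error has probability at most `δ`, and `w = exp ε - 1 + 6δ/β`, makes `Pr[E] ≤ β`.

The minimum exists because, in the coordinates `(σ, x)` with `δ = k * erfc x`, the objective is
continuous with compact sublevel sets. -/

/-! ### The complementary error function and its inverse -/

theorem continuous_exp_neg_sq : Continuous fun t : ℝ => Real.exp (-t ^ 2) := by fun_prop

theorem continuous_erfc : Continuous erfc := by
  unfold erfc
  have h : Continuous fun x : ℝ => ∫ t in (0 : ℝ)..x, Real.exp (-t ^ 2) :=
    intervalIntegral.continuous_primitive
      (fun a b => continuous_exp_neg_sq.intervalIntegrable a b) 0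
  fun_prop

theorem erfc_zero : erfc 0 = 1 := by simp [erfc]

theorem strictAnti_erfc : StrictAnti erfc := by
  intro x y hxy
  have h1 := intervalIntegral.integral_add_adjacent_intervals
    (continuous_exp_neg_sq.intervalIntegrable (μ := volume) 0 x)
    (continuous_exp_neg_sq.intervalIntegrable (μ := volume) x y)
  have h2 : 0 < ∫ t in x..y, Real.exp (-t ^ 2) :=
    intervalIntegral.intervalIntegral_pos_of_pos
      (continuous_exp_neg_sq.intervalIntegrable x y) (fun t => Real.exp_pos _) hxy
  have h3 : 0 < 2 / √Real.pi := by positivity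
  unfold erfc
  rw [← h1]
  nlinarith [mul_pos h3 h2]

theorem tendsto_erfc_atTop : Filter.Tendsto erfc Filter.atTop (nhds 0) := by
  have h0 : ∫ t in Set.Ioi (0 : ℝ), Real.exp (-t ^ 2) = √Real.pi / 2 := by
    simpa using integral_gaussian_Ioi 1
  have hi : IntegrableOn (fun t : ℝ => Real.exp (-t ^ 2)) (Set.Ioi 0) := by
    simpa using (integrable_exp_neg_mul_sq (b := 1) one_pos).integrableOn
  have h := intervalIntegral_tendsto_integral_Ioi 0 hi Filter.tendsto_id
  rw [h0] at h
  have h' := (h.const_mul (2 / √Real.pi)).const_sub 1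
  have hpi : √Real.pi ≠ 0 := by positivity
  have e : 1 - 2 / √Real.pi * (√Real.pi / 2) = 0 := by field_simp; ring
  rw [e] at h'
  exact h'

theorem erfc_pos (x : ℝ) : 0 < erfc x :=
  lt_of_le_of_lt (le_of_tendsto tendsto_erfc_atTop (Filter.eventually_atTop.2
    ⟨x + 1, fun _ hy => strictAnti_erfc.antitone hy⟩)) (strictAnti_erfc (lt_add_one x))

theorem erfcInv_erfc (x : ℝ) : erfcInv (erfc x) = x :=
  Function.leftInverse_invFun strictAnti_erfc.injective x

theorem exists_erfc_eq {y : ℝ} (h0 : 0 < y) (h1 : y ≤ 1) : ∃ x, 0 ≤ x ∧ erfc x = y := by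
  obtain ⟨b, hb, hb'⟩ := ((tendsto_erfc_atTop.eventually_lt_const h0).and
    (Filter.eventually_ge_atTop 0)).exists
  obtain ⟨x, hx, e⟩ := intermediate_value_Icc' hb' continuous_erfc.continuousOn
    (show y ∈ Set.Icc (erfc b) (erfc 0) from ⟨hb.le, by rwa [erfc_zero]⟩)
  exact ⟨x, hx.1, e⟩

theorem erfc_erfcInv {y : ℝ} (h0 : 0 < y) (h1 : y ≤ 1) : erfc (erfcInv y) = y := by
  obtain ⟨x, -, rfl⟩ := exists_erfc_eq h0 h1
  rw [erfcInv_erfc]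

theorem erfcInv_nonneg {y : ℝ} (h0 : 0 < y) (h1 : y ≤ 1) : 0 ≤ erfcInv y := by
  obtain ⟨x, hx, rfl⟩ := exists_erfc_eq h0 h1
  rwa [erfcInv_erfc]

/-! ### Existence and range of the minimum -/

theorem rho_pos {k n : ℕ} (hk : 0 < k) (hn : 0 < n) {σ : ℝ} (hσ : 0 < σ) : 0 < rho k n σ := by
  unfold rho; positivity

theorem rho_le_privacyEps (k n : ℕ) (σ δ : ℝ) : rho k n σ ≤ privacyEps k n σ δ :=
  le_add_of_nonneg_right (Real.sqrt_nonneg _)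

theorem lt_exp_privacyEps_sub_one {k n : ℕ} (hk : 0 < k) (hn : 0 < n) {σ : ℝ} (hσ : 0 < σ)
    (δ : ℝ) : rho k n σ < Real.exp (privacyEps k n σ δ) - 1 := by
  have h := rho_le_privacyEps k n σ δ
  have := Real.add_one_lt_exp ((rho_pos hk hn hσ).trans_le h).ne'
  linarith

/-- The objective in the coordinates `(σ, x)`, where `δ = k * erfc x`. -/
noncomputable def objectiveErfc (k n : ℕ) (β : ℝ) (p : ℝ × ℝ) : ℝ :=
  √2 * p.1 * p.2 + Real.exp (privacyEps k n p.1 (k * erfc p.2)) - 1 + 6 * (k * erfc p.2 / β)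

theorem objective_mul_erfc {k n : ℕ} (hk : 0 < k) (β σ x : ℝ) :
    objective k n β σ (k * erfc x) = objectiveErfc k n β (σ, x) := by
  have : (k : ℝ) ≠ 0 := by positivity
  simp [objective, objectiveErfc, mul_div_cancel_left₀ _ this, erfcInv_erfc]

theorem continuousOn_objectiveErfc {k n : ℕ} (hk : 0 < k) (hn : 0 < n) (β : ℝ) :
    ContinuousOn (objectiveErfc k n β) {p | 0 < p.1} := by
  have hk' : (0 : ℝ) < k := by positivity
  have hn' : (0 : ℝ) < n := by positivity
  have he : Continuous fun p : ℝ × ℝ => (k : ℝ) * erfc p.2 :=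
    (continuous_erfc.comp continuous_snd).const_mul _
  have hr : ContinuousOn (fun p : ℝ × ℝ => rho k n p.1) {p | 0 < p.1} := by
    unfold rho
    refine continuousOn_const.div (by fun_prop) fun p (hp : 0 < p.1) => by positivity
  have hk2 : ContinuousOn (fun p : ℝ × ℝ => (k : ℝ) / ((n : ℝ) ^ 2 * p.1 ^ 2))
      {p | 0 < p.1} :=
    continuousOn_const.div (by fun_prop) fun p (hp : 0 < p.1) => by positivity
  have hl : ContinuousOn (fun p : ℝ × ℝ =>
      Real.log (√(Real.pi * rho k n p.1) / (k * erfc p.2))) {p | 0 < p.1} := by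
    refine ContinuousOn.log ((continuousOn_const.mul hr).sqrt.div he.continuousOn
      fun p _ => (mul_pos hk' (erfc_pos _)).ne') fun p (hp : 0 < p.1) => ?_
    have := rho_pos hk hn hp
    have := erfc_pos p.2
    positivity
  have hε : ContinuousOn (fun p : ℝ × ℝ => privacyEps k n p.1 (k * erfc p.2))
      {p | 0 < p.1} := by
    unfold privacyEps
    exact hr.add ((continuousOn_const.mul hk2).mul (hl.sup continuousOn_const)).sqrt
  unfold objectiveErfc
  exact ((((continuous_const.mul continuous_fst).mul continuous_snd).continuousOn.add
    hε.rexp).sub continuousOn_const).add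
    (continuous_const.mul (he.div_const β)).continuousOn

/-- The objective dominates both `ρ` and `σ x`. On a sublevel set the first keeps `σ` away from `0`,
and the second then bounds `x`; since `x ≥ b > 0` it also bounds `σ`. So the sublevel set lies in a
compact rectangle. -/
theorem exists_isMinOn_objectiveErfc {k n : ℕ} (hk : 0 < k) (hn : 0 < n) {β : ℝ} (hβ : 0 < β)
    {b : ℝ} (hb : 0 < b) :
    ∃ p ∈ {p : ℝ × ℝ | 0 < p.1 ∧ b ≤ p.2},
      IsMinOn (objectiveErfc k n β) {p : ℝ × ℝ | 0 < p.1 ∧ b ≤ p.2} p := by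
  have hk' : (0 : ℝ) < k := by positivity
  have hn' : (0 : ℝ) < n := by positivity
  set C := objectiveErfc k n β (1, b) with hC
  have key : ∀ p : ℝ × ℝ, 0 < p.1 → b ≤ p.2 → objectiveErfc k n β p ≤ C →
      rho k n p.1 ≤ C ∧ p.1 * p.2 ≤ C := by
    intro p hp hp2 h
    have h1 := lt_exp_privacyEps_sub_one hk hn hp (k * erfc p.2)
    have h2 := rho_pos hk hn hp
    have h3 : 0 < 6 * (k * erfc p.2 / β) := by have := erfc_pos p.2; positivity
    have h4 : 0 < p.1 * p.2 := mul_pos hp (hb.trans_le hp2)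
    have h5 : p.1 * p.2 ≤ √2 * p.1 * p.2 := by
      have : (1 : ℝ) ≤ √2 := Real.one_le_sqrt.2 (by norm_num)
      nlinarith
    unfold objectiveErfc at h
    constructor <;> linarith
  have hCpos : 0 < C := by
    have := (key (1, b) one_pos le_rfl le_rfl).2
    simp only [one_mul] at this
    exact hb.trans_le this
  -- The value of `σ` at which `ρ = C`.
  set s := √(k / (2 * (n : ℝ) ^ 2 * C)) with hs
  have hspos : 0 < s := Real.sqrt_pos.2 (by positivity)
  have key2 : ∀ p : ℝ × ℝ, 0 < p.1 → b ≤ p.2 → objectiveErfc k n β p ≤ C →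
      p ∈ Set.Icc s (C / b) ×ˢ Set.Icc b (C / s) := by
    intro p hp hp2 h
    obtain ⟨h1, h2⟩ := key p hp hp2 h
    have h3 : s ≤ p.1 := by
      rw [hs, Real.sqrt_le_left hp.le, div_le_iff₀ (by positivity)]
      unfold rho at h1
      rw [div_le_iff₀ (by positivity)] at h1
      linarith
    refine ⟨⟨h3, ?_⟩, hp2, ?_⟩
    · rw [le_div_iff₀ hb]; nlinarith
    · rw [le_div_iff₀ hspos]; nlinarith
  have hK : IsCompact (Set.Icc s (C / b) ×ˢ Set.Icc b (C / s)) :=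
    isCompact_Icc.prod isCompact_Icc
  obtain ⟨p, hp, hmin⟩ := hK.exists_isMinOn ⟨(1, b), key2 (1, b) one_pos le_rfl le_rfl⟩
    ((continuousOn_objectiveErfc hk hn β).mono fun p hp => hspos.trans_le hp.1.1)
  refine ⟨p, ⟨hspos.trans_le hp.1.1, hp.2.1⟩, fun y hy => ?_⟩
  by_cases h : objectiveErfc k n β y ≤ C
  · exact hmin (key2 y hy.1 hy.2 h)
  · exact (hmin (key2 (1, b) one_pos le_rfl le_rfl)).trans (not_le.1 h).le

theorem exists_isLeast_objectiveValues {k n : ℕ} (hk : 0 < k) (hn : 0 < n) {β : ℝ}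
    (hβ0 : 0 < β) (hβ1 : β < 1) : ∃ α, IsLeast (objectiveValues k n β β) α := by
  have hk' : (0 : ℝ) < k := by positivity
  have hk1 : (1 : ℝ) ≤ k := by exact_mod_cast hk
  obtain ⟨b, hb, e⟩ := exists_erfc_eq (y := β / k) (by positivity)
    ((div_le_one hk').2 (hβ1.le.trans hk1))
  have e' : k * erfc b = β := by rw [e]; field_simp
  -- Here `β < 1 ≤ k` matters: it excludes `erfc b = 1`.
  have hb' : 0 < b := by
    refine hb.lt_of_ne fun h => ?_
    rw [← h, erfc_zero] at e'
    linarith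
  obtain ⟨p, hp, hmin⟩ := exists_isMinOn_objectiveErfc hk hn hβ0 hb'
  refine ⟨objectiveErfc k n β p, ⟨p.1, k * erfc p.2, hp.1, mul_pos hk' (erfc_pos _), ?_,
    (objective_mul_erfc hk β p.1 p.2).symm⟩, ?_⟩
  · rw [← e']
    exact mul_le_mul_of_nonneg_left (strictAnti_erfc.antitone hp.2) hk'.le
  · rintro a ⟨σ, δ, hσ, hδ, hδβ, rfl⟩
    obtain ⟨x, -, hx⟩ := exists_erfc_eq (y := δ / k) (by positivity)
      ((div_le_one hk').2 (by linarith))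
    have hx' : k * erfc x = δ := by rw [hx]; field_simp
    rw [← hx', objective_mul_erfc hk]
    refine hmin ⟨hσ, strictAnti_erfc.le_iff_ge.1 ?_⟩
    rw [hx, e]
    gcongr

/-- For `δ > β` the last term alone exceeds `6`, and the others are nonnegative as long as `δ / k ≤
1`. -/
theorem isLeast_objectiveValues_of_le_six {k n : ℕ} (hk : 0 < k) (hn : 0 < n) {β α : ℝ}
    (hβ0 : 0 < β) (hβ1 : β < 1) (h : IsLeast (objectiveValues k n β β) α) (hα : α ≤ 6) :
    IsLeast (objectiveValues k n β k) α := by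
  have hk' : (0 : ℝ) < k := by positivity
  have hk1 : (1 : ℝ) ≤ k := by exact_mod_cast hk
  obtain ⟨⟨σ, δ, hσ, hδ, hδβ, e⟩, hl⟩ := h
  refine ⟨⟨σ, δ, hσ, hδ, by linarith, e⟩, ?_⟩
  rintro a ⟨σ, δ, hσ, hδ, hδk, rfl⟩
  by_cases hδβ : δ ≤ β
  · exact hl ⟨σ, δ, hσ, hδ, hδβ, rfl⟩
  have h1 := lt_exp_privacyEps_sub_one hk hn hσ δ
  have h2 := rho_pos hk hn hσ
  have h3 : 0 ≤ √2 * σ * erfcInv (δ / k) :=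
    mul_nonneg (by positivity) (erfcInv_nonneg (by positivity) ((div_le_one hk').2 hδk))
  have h4 : 1 ≤ δ / β := (one_le_div hβ0).2 (not_le.1 hδβ).le
  unfold objective
  linarith

/-! ### Gaussian tails and likelihood ratios -/

theorem integral_gaussianPDFReal_Ioo (m : ℝ) {σ : ℝ} (hσ : 0 < σ) {a : ℝ} (ha : 0 ≤ a) :
    ∫ x in Set.Ioo (m - a) (m + a), gaussianPDFReal m (Real.toNNReal (σ ^ 2)) x =
      1 - erfc (a / (√2 * σ)) := by
  have h2 : (0 : ℝ) < √2 := by positivity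
  have hc : (√2 * σ) ≠ 0 := by positivity
  have hpdf : ∀ x, gaussianPDFReal m (Real.toNNReal (σ ^ 2)) x =
      (√Real.pi)⁻¹ * ((√2 * σ)⁻¹ * Real.exp (-((x - m) / (√2 * σ)) ^ 2)) := by
    intro x
    rw [gaussianPDFReal, Real.coe_toNNReal _ (sq_nonneg σ)]
    have e1 : √(2 * Real.pi * σ ^ 2) = √Real.pi * (√2 * σ) := by
      rw [Real.sqrt_mul (by positivity), Real.sqrt_mul (by positivity), Real.sqrt_sq hσ.le]
      ring
    have e2 : -(x - m) ^ 2 / (2 * σ ^ 2) = -((x - m) / (√2 * σ)) ^ 2 := by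
      rw [div_pow, mul_pow, Real.sq_sqrt (by norm_num)]
      ring
    rw [e1, e2, mul_inv, mul_assoc]
  rw [← integral_Ioc_eq_integral_Ioo, ← intervalIntegral.integral_of_le (by linarith)]
  simp_rw [hpdf]
  rw [intervalIntegral.integral_const_mul, intervalIntegral.integral_const_mul,
    intervalIntegral.integral_comp_sub_right (fun y => Real.exp (-(y / (√2 * σ)) ^ 2)) m,
    intervalIntegral.integral_comp_div (fun y => Real.exp (-y ^ 2)) hc, smul_eq_mul,
    inv_mul_cancel_left₀ hc]
  have e3 : (m - a - m) / (√2 * σ) = -(a / (√2 * σ)) := by ring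
  have e4 : (m + a - m) / (√2 * σ) = a / (√2 * σ) := by ring
  rw [e3, e4]
  set x := a / (√2 * σ)
  have e5 : ∫ t in (-x)..0, Real.exp (-t ^ 2) = ∫ t in (0 : ℝ)..x, Real.exp (-t ^ 2) := by
    have := intervalIntegral.integral_comp_neg (a := 0) (b := x) fun t : ℝ => Real.exp (-t ^ 2)
    simpa using this.symm
  rw [← intervalIntegral.integral_add_adjacent_intervals
    (continuous_exp_neg_sq.intervalIntegrable (-x) 0)
    (continuous_exp_neg_sq.intervalIntegrable 0 x), e5, erfc]
  ring

theorem toNNReal_sq_ne_zero {σ : ℝ} (hσ : 0 < σ) : Real.toNNReal (σ ^ 2) ≠ 0 := by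
  rw [Ne, Real.toNNReal_eq_zero, not_le]
  positivity

theorem gaussianReal_le_abs_sub (m : ℝ) {σ : ℝ} (hσ : 0 < σ) {a : ℝ} (ha : 0 ≤ a) :
    gaussianReal m (Real.toNNReal (σ ^ 2)) {x | a ≤ |m - x|} =
      ENNReal.ofReal (erfc (a / (√2 * σ))) := by
  have hs : {x | a ≤ |m - x|} = (Set.Ioo (m - a) (m + a))ᶜ := by
    ext x
    rw [Set.mem_ofPred_eq, Set.mem_compl_iff, Set.mem_Ioo, ← not_lt, abs_lt, not_iff_not]
    constructor <;> rintro ⟨h1, h2⟩ <;> constructor <;> linarith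
  have hle : erfc (a / (√2 * σ)) ≤ 1 := by
    rw [← erfc_zero]
    exact strictAnti_erfc.antitone (by positivity)
  rw [hs, prob_compl_eq_one_sub measurableSet_Ioo,
    gaussianReal_apply_eq_integral _ (toNNReal_sq_ne_zero hσ),
    integral_gaussianPDFReal_Ioo m hσ ha, ← ENNReal.ofReal_one,
    ← ENNReal.ofReal_sub _ (by linarith)]
  ring_nf

/-- The log-likelihood ratio of `N(m, v)` and `N(m', v)` at `a`. -/
noncomputable def gaussianLoss (v m m' a : ℝ) : ℝ := ((a - m') ^ 2 - (a - m) ^ 2) / (2 * v)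

theorem gaussianPDF_mul_exp_neg_gaussianLoss (m m' : ℝ) {σ : ℝ} (a : ℝ) :
    gaussianPDF m (Real.toNNReal (σ ^ 2)) a *
      ENNReal.ofReal (Real.exp (-gaussianLoss (σ ^ 2) m m' a)) =
      gaussianPDF m' (Real.toNNReal (σ ^ 2)) a := by
  rw [gaussianPDF, gaussianPDF, ← ENNReal.ofReal_mul (gaussianPDFReal_nonneg _ _ _),
    gaussianPDFReal, gaussianPDFReal, mul_assoc, ← Real.exp_add,
    Real.coe_toNNReal _ (sq_nonneg σ), gaussianLoss]
  congr 3
  ring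

theorem lintegral_gaussianReal_exp_neg_gaussianLoss (m m' : ℝ) {σ : ℝ} (hσ : 0 < σ)
    {g : ℝ → ENNReal} (hg : Measurable g) :
    ∫⁻ a, ENNReal.ofReal (Real.exp (-gaussianLoss (σ ^ 2) m m' a)) * g a
      ∂gaussianReal m (Real.toNNReal (σ ^ 2)) =
      ∫⁻ a, g a ∂gaussianReal m' (Real.toNNReal (σ ^ 2)) := by
  have hv := toNNReal_sq_ne_zero hσ
  have hm : Measurable fun a => ENNReal.ofReal (Real.exp (-gaussianLoss (σ ^ 2) m m' a)) := by
    unfold gaussianLoss; fun_prop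
  rw [gaussianReal_of_var_ne_zero _ hv, gaussianReal_of_var_ne_zero _ hv,
    lintegral_withDensity_eq_lintegral_mul _ (measurable_gaussianPDF _ _)
      (show Measurable fun a => ENNReal.ofReal (Real.exp (-gaussianLoss (σ ^ 2) m m' a)) * g a
        from hm.mul hg),
    lintegral_withDensity_eq_lintegral_mul _ (measurable_gaussianPDF _ _) hg]
  refine lintegral_congr fun a => ?_
  simp only [Pi.mul_apply]
  rw [← mul_assoc, gaussianPDF_mul_exp_neg_gaussianLoss]

/-- The loss is affine in `a`, so this is the Gaussian moment generating function: the Rényi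
divergence of two Gaussians of equal variance. -/
theorem lintegral_gaussianReal_exp_mul_gaussianLoss (m m' : ℝ) {σ : ℝ} (hσ : 0 < σ) (l : ℝ) :
    ∫⁻ a, ENNReal.ofReal (Real.exp (l * gaussianLoss (σ ^ 2) m m' a))
      ∂gaussianReal m (Real.toNNReal (σ ^ 2)) =
      ENNReal.ofReal (Real.exp (l * (l + 1) * ((m - m') ^ 2 / (2 * σ ^ 2)))) := by
  have hσ2 : σ ≠ 0 := hσ.ne'
  set s := l * (m - m') / σ ^ 2 with hs
  set c := l * (m' ^ 2 - m ^ 2) / (2 * σ ^ 2) with hc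
  have e : ∀ a, Real.exp (l * gaussianLoss (σ ^ 2) m m' a) = Real.exp c * Real.exp (s * a) := by
    intro a
    rw [← Real.exp_add, gaussianLoss, hs, hc]
    congr 1
    field_simp
    ring
  have hi := (integrable_exp_mul_gaussianReal (μ := m) (v := Real.toNNReal (σ ^ 2)) s).const_mul
    (Real.exp c)
  simp_rw [e]
  rw [← ofReal_integral_eq_lintegral_ofReal hi (.of_forall fun a => by positivity),
    integral_const_mul]
  have h := congrFun (mgf_fun_id_gaussianReal (μ := m) (v := Real.toNNReal (σ ^ 2))) s
  rw [mgf, Real.coe_toNNReal _ (sq_nonneg σ)] at h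
  rw [h, ← Real.exp_add, hs, hc]
  congr 2
  field_simp
  ring

/-! ### The law of the transcript -/

section

variable {X Q : Type*} [MeasurableSpace X] [MeasurableSpace Q] {n : ℕ}

theorem lintegral_interact_succ (M : Estimator X Q n) (A : Analyst Q) (t : ℕ) (S : Fin n → X)
    {g : Transcript Q (t + 1) → ENNReal} (hg : Measurable g) :
    ∫⁻ π, g π ∂interact M A (t + 1) S =
      ∫⁻ π, ∫⁻ q, ∫⁻ a, g (Fin.snoc π (q, a)) ∂M.answer t (S, (π, q)) ∂A.next t π
        ∂interact M A t S := by
  have := A.markov t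
  have := M.markov t
  have hm := measurable_transcript_snoc (Q := Q) t
  have hg' : Measurable fun p : (Transcript Q t × Q) × ℝ =>
      g (Fin.snoc p.1.1 (p.1.2, p.2)) := hg.comp hm
  rw [interact, Kernel.map_apply _ hm, lintegral_map hg hm,
    Kernel.lintegral_compProd _ _ _ hg']
  exact Kernel.lintegral_compProd _ _ S (Measurable.lintegral_kernel_prod_right'
    (κ := (M.answer t).comap (Prod.mk S) measurable_prodMk_left) hg')

theorem lintegral_interact_gaussianMechanism_succ (L : LinearQueryFamily X Q) (σ : ℝ)
    (A : Analyst Q) (t : ℕ) (S : Fin n → X) {g : Transcript Q (t + 1) → ENNReal}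
    (hg : Measurable g) :
    ∫⁻ π, g π ∂interact (gaussianMechanism L n σ) A (t + 1) S =
      ∫⁻ π, ∫⁻ q, ∫⁻ a, g (Fin.snoc π (q, a))
        ∂gaussianReal (L.empirical q S) (Real.toNNReal (σ ^ 2)) ∂A.next t π
        ∂interact (gaussianMechanism L n σ) A t S :=
  lintegral_interact_succ _ A t S hg

/-- The log-likelihood ratio of a transcript of the Gaussian mechanism, for the datasets `S` and
`S'`. -/
noncomputable def transcriptLoss (L : LinearQueryFamily X Q) (σ : ℝ) (S S' : Fin n → X) {t : ℕ}
    (π : Transcript Q t) : ℝ :=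
  ∑ j, gaussianLoss (σ ^ 2) (L.empirical (π j).1 S) (L.empirical (π j).1 S') (π j).2

theorem transcriptLoss_snoc (L : LinearQueryFamily X Q) (σ : ℝ) (S S' : Fin n → X) {t : ℕ}
    (π : Transcript Q t) (q : Q) (a : ℝ) :
    transcriptLoss L σ S S' (Fin.snoc π (q, a) : Transcript Q (t + 1)) =
      transcriptLoss L σ S S' π +
        gaussianLoss (σ ^ 2) (L.empirical q S) (L.empirical q S') a := by
  simp [transcriptLoss, Fin.sum_univ_castSucc]

theorem LinearQueryFamily.measurable_empirical_left (L : LinearQueryFamily X Q)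
    (S : Fin n → X) : Measurable fun q => L.empirical q S :=
  L.measurable_empirical.comp measurable_prodMk_right

theorem measurable_transcriptLoss (L : LinearQueryFamily X Q) (σ : ℝ) (S S' : Fin n → X)
    (t : ℕ) : Measurable (transcriptLoss L σ S S' : Transcript Q t → ℝ) := by
  have h1 := L.measurable_empirical_left S
  have h2 := L.measurable_empirical_left S'
  unfold transcriptLoss gaussianLoss
  fun_prop

/-- Change of measure from `S` to `S'`. Only the answers contribute to the density, because the law
of the next query given the transcript does not involve the dataset. -/
theorem lintegral_interact_exp_neg_transcriptLoss (L : LinearQueryFamily X Q) {σ : ℝ}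
    (hσ : 0 < σ) (A : Analyst Q) (S S' : Fin n → X) (t : ℕ) {g : Transcript Q t → ENNReal}
    (hg : Measurable g) :
    ∫⁻ π, ENNReal.ofReal (Real.exp (-transcriptLoss L σ S S' π)) * g π
      ∂interact (gaussianMechanism L n σ) A t S =
      ∫⁻ π, g π ∂interact (gaussianMechanism L n σ) A t S' := by
  induction t with
  | zero => simp [transcriptLoss, interact]
  | succ t ih =>
    have := A.markov t
    have hl : ∀ t, Measurable fun π : Transcript Q t =>
        ENNReal.ofReal (Real.exp (-transcriptLoss L σ S S' π)) := fun t =>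
      (measurable_transcriptLoss L σ S S' t).neg.exp.ennreal_ofReal
    have hs := measurable_transcript_snoc (Q := Q) t
    have hsnoc : ∀ (π : Transcript Q t) (q : Q),
        Measurable fun a : ℝ => g (Fin.snoc π (q, a)) := fun π q =>
      (hg.comp hs).comp (measurable_prodMk_left (x := (π, q)))
    rw [lintegral_interact_gaussianMechanism_succ _ _ _ _ _ (g := fun π =>
      ENNReal.ofReal (Real.exp (-transcriptLoss L σ S S' π)) * g π) ((hl _).mul hg),
      lintegral_interact_gaussianMechanism_succ _ _ _ _ _ hg]
    have hm : Measurable fun p : Transcript Q t × Q =>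
        ∫⁻ a, g (Fin.snoc p.1 (p.2, a))
          ∂gaussianReal (L.empirical p.2 S') (Real.toNNReal (σ ^ 2)) := by
      have := (gaussianMechanism L n σ).markov t
      exact Measurable.lintegral_kernel_prod_right'
        (κ := ((gaussianMechanism L n σ).answer t).comap (Prod.mk S') measurable_prodMk_left)
        (hg.comp hs)
    -- The induction hypothesis is applied to the last round already integrated under `S'`.
    rw [← ih hm.lintegral_kernel_prod_right']
    refine lintegral_congr fun π => ?_
    rw [← lintegral_const_mul' _ _ ENNReal.ofReal_ne_top]
    refine lintegral_congr fun q => ?_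
    rw [← lintegral_gaussianReal_exp_neg_gaussianLoss (L.empirical q S) (L.empirical q S') hσ
      (hsnoc π q), ← lintegral_const_mul']
    · refine lintegral_congr fun a => ?_
      rw [transcriptLoss_snoc, neg_add, Real.exp_add, ENNReal.ofReal_mul (Real.exp_pos _).le,
        mul_assoc]
    · exact ENNReal.ofReal_ne_top

/-- Adaptive composition: given any past and any query, a further round multiplies the moment by at
most the same constant. -/
theorem lintegral_interact_exp_mul_transcriptLoss_le (L : LinearQueryFamily X Q) {σ : ℝ}
    (hσ : 0 < σ) (A : Analyst Q) (S S' : Fin n → X)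
    {Δ : ℝ} (hΔ : ∀ q, |L.empirical q S - L.empirical q S'| ≤ Δ) (t : ℕ) {l : ℝ} (hl : 0 ≤ l) :
    ∫⁻ π, ENNReal.ofReal (Real.exp (l * transcriptLoss L σ S S' π))
      ∂interact (gaussianMechanism L n σ) A t S ≤
      ENNReal.ofReal (Real.exp (l * (l + 1) * (t * (Δ ^ 2 / (2 * σ ^ 2))))) := by
  induction t with
  | zero => simp [transcriptLoss, interact]
  | succ t ih =>
    have := A.markov t
    have hm : ∀ t, Measurable fun π : Transcript Q t =>
        ENNReal.ofReal (Real.exp (l * transcriptLoss L σ S S' π)) := fun t =>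
      ((measurable_transcriptLoss L σ S S' t).const_mul l).exp.ennreal_ofReal
    rw [lintegral_interact_gaussianMechanism_succ _ _ _ _ _ (hm _)]
    set C := Real.exp (l * (l + 1) * (Δ ^ 2 / (2 * σ ^ 2))) with hC
    calc _ ≤ ∫⁻ π, ∫⁻ q, ENNReal.ofReal (Real.exp (l * transcriptLoss L σ S S' π)) *
          ENNReal.ofReal C ∂A.next t π ∂interact (gaussianMechanism L n σ) A t S := by
          refine lintegral_mono fun π => lintegral_mono fun q => ?_
          simp only [transcriptLoss_snoc, mul_add, Real.exp_add]
          simp_rw [ENNReal.ofReal_mul (Real.exp_pos _).le]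
          rw [lintegral_const_mul' _ _ ENNReal.ofReal_ne_top,
            lintegral_gaussianReal_exp_mul_gaussianLoss _ _ hσ]
          have hsq := sq_le_sq' (abs_le.1 (hΔ q)).1 (abs_le.1 (hΔ q)).2
          rw [hC]
          gcongr
      _ = (∫⁻ π, ENNReal.ofReal (Real.exp (l * transcriptLoss L σ S S' π))
          ∂interact (gaussianMechanism L n σ) A t S) * ENNReal.ofReal C := by
          simp only [lintegral_const, measure_univ, mul_one]
          rw [lintegral_mul_const' _ _ ENNReal.ofReal_ne_top]
      _ ≤ _ := by
          refine (mul_le_mul_left ih _).trans_eq ?_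
          rw [← ENNReal.ofReal_mul (Real.exp_pos _).le, hC, ← Real.exp_add]
          congr 2
          push_cast
          ring

/-- A union bound over the rounds. Adaptivity is harmless, since the miss probability of a new
answer is the same for every past and every query. -/
theorem interact_gaussianMechanism_exists_le (L : LinearQueryFamily X Q) {σ : ℝ} (hσ : 0 < σ)
    (A : Analyst Q) (S : Fin n → X) {a : ℝ} (ha : 0 ≤ a) (t : ℕ) :
    interact (gaussianMechanism L n σ) A t S
      {π | ∃ j, a ≤ |L.empirical (π j).1 S - (π j).2|} ≤
      t * ENNReal.ofReal (erfc (a / (√2 * σ))) := by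
  have hE := L.measurable_empirical_left S
  have hB : ∀ t, MeasurableSet {π : Transcript Q t | ∃ j,
      a ≤ |L.empirical (π j).1 S - (π j).2|} := fun t => by
    simp only [Set.ofPred_exists]
    exact MeasurableSet.iUnion fun j => measurableSet_le measurable_const (by fun_prop)
  induction t with
  | zero => simp
  | succ t ih =>
    have := A.markov t
    set B := fun t => {π : Transcript Q t | ∃ j, a ≤ |L.empirical (π j).1 S - (π j).2|} with hBdef
    set p := ENNReal.ofReal (erfc (a / (√2 * σ))) with hp
    have hB' : ∀ t, MeasurableSet (B t) := hB
    change interact (gaussianMechanism L n σ) A (t + 1) S (B (t + 1)) ≤ _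
    rw [← lintegral_indicator_one (hB' _), lintegral_interact_gaussianMechanism_succ _ _ _ _ _
      (measurable_one.indicator (hB' _))]
    calc _ ≤ ∫⁻ π, ((B t).indicator 1 π + p) ∂interact (gaussianMechanism L n σ) A t S := by
          refine lintegral_mono fun π => ?_
          calc _ ≤ ∫⁻ q, ((B t).indicator 1 π + p) ∂A.next t π := by
                refine lintegral_mono fun q => ?_
                have hV : MeasurableSet {x : ℝ | a ≤ |L.empirical q S - x|} :=
                  measurableSet_le measurable_const (by fun_prop)
                calc _ ≤ ∫⁻ x, ((B t).indicator 1 π +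
                      {x : ℝ | a ≤ |L.empirical q S - x|}.indicator 1 x)
                      ∂gaussianReal (L.empirical q S) (Real.toNNReal (σ ^ 2)) := by
                      refine lintegral_mono fun x => ?_
                      by_cases h : (Fin.snoc π (q, x) : Transcript Q (t + 1)) ∈ B (t + 1)
                      · rw [Set.indicator_of_mem h]
                        obtain ⟨j, hj⟩ := h
                        induction j using Fin.lastCases with
                        | last =>
                          rw [Fin.snoc_last] at hj
                          rw [Set.indicator_of_mem (s := {x : ℝ | a ≤ |L.empirical q S - x|}) hj]
                          exact le_add_self
                        | cast j =>
                          rw [Fin.snoc_castSucc] at hj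
                          rw [Set.indicator_of_mem (show π ∈ B t from ⟨j, hj⟩)]
                          exact le_self_add
                      · rw [Set.indicator_of_notMem h]
                        exact zero_le
                  _ = _ := by
                      rw [lintegral_add_left measurable_const, lintegral_const, measure_univ,
                        mul_one, lintegral_indicator_one hV, gaussianReal_le_abs_sub _ hσ ha]
            _ = _ := by rw [lintegral_const, measure_univ, mul_one]
      _ = interact (gaussianMechanism L n σ) A t S (B t) + p := by
          rw [lintegral_add_right _ measurable_const, lintegral_const, measure_univ, mul_one,
            lintegral_indicator_one (hB' _)]
      _ ≤ _ := by
          push_cast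
          rw [add_mul, one_mul]
          gcongr

end

/-! ### From moments of the loss to differential privacy -/

section Privacy

theorem measure_add_le_le_exp {Ω : Type*} [MeasurableSpace Ω] {ν : Measure Ω} {Z : Ω → ℝ}
    (hZ : Measurable Z) {ρ : ℝ} (hρ : 0 < ρ)
    (hmom : ∀ l, 0 ≤ l →
      ∫⁻ ω, ENNReal.ofReal (Real.exp (l * Z ω)) ∂ν ≤ ENNReal.ofReal (Real.exp (l * (l + 1) * ρ)))
    {t : ℝ} (ht : 0 ≤ t) :
    ν {ω | ρ + t ≤ Z ω} ≤ ENNReal.ofReal (Real.exp (-(t ^ 2 / (4 * ρ)))) := by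
  -- The minimizer of the Chernoff exponent `l (l + 1) ρ - l (ρ + t) = l² ρ - l t`.
  set l := t / (2 * ρ) with hl
  have hl0 : 0 ≤ l := by positivity
  have h1 : ENNReal.ofReal (Real.exp (l * (ρ + t))) * ν {ω | ρ + t ≤ Z ω} ≤
      ENNReal.ofReal (Real.exp (l * (l + 1) * ρ)) := by
    refine le_trans ?_ (hmom l hl0)
    refine le_trans ?_ (mul_meas_ge_le_lintegral (hZ.const_mul l).exp.ennreal_ofReal
      (ENNReal.ofReal (Real.exp (l * (ρ + t)))))
    gcongr with ω
    intro h
    gcongr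
  have h2 : ENNReal.ofReal (Real.exp (-(t ^ 2 / (4 * ρ)))) =
      ENNReal.ofReal (Real.exp (-(l * (ρ + t)))) *
        ENNReal.ofReal (Real.exp (l * (l + 1) * ρ)) := by
    rw [← ENNReal.ofReal_mul (Real.exp_pos _).le, ← Real.exp_add, hl]
    congr 2
    field_simp
    ring
  rw [h2]
  refine le_trans ?_ (mul_le_mul_right h1 _)
  rw [← mul_assoc, ← ENNReal.ofReal_mul (Real.exp_pos _).le, ← Real.exp_add]
  simp

/-- By the layer cake formula the left side is `∫ exp (-u) ν{Z ≥ ρ + t + u} du` over `u > 0`.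
Bounding `exp (-u)` by `1` and `(u + t)²` below by `u² + t²` leaves half a Gaussian integral, which
is `√(π ρ)`. -/
theorem lintegral_one_sub_exp_le {Ω : Type*} [MeasurableSpace Ω] {ν : Measure Ω} {Z : Ω → ℝ}
    (hZ : Measurable Z) {ρ : ℝ} (hρ : 0 < ρ)
    (hmom : ∀ l, 0 ≤ l →
      ∫⁻ ω, ENNReal.ofReal (Real.exp (l * Z ω)) ∂ν ≤ ENNReal.ofReal (Real.exp (l * (l + 1) * ρ)))
    {t : ℝ} (ht : 0 ≤ t) :
    ∫⁻ ω, ENNReal.ofReal (1 - Real.exp (ρ + t - Z ω)) ∂ν ≤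
      ENNReal.ofReal (√(Real.pi * ρ) * Real.exp (-(t ^ 2 / (4 * ρ)))) := by
  have hint : ∀ x : ℝ, ∫ u in (0 : ℝ)..x, Real.exp (-u) = 1 - Real.exp (-x) := fun x => by
    rw [intervalIntegral.integral_comp_neg (fun u => Real.exp u), integral_exp]
    simp
  have h1 := lintegral_comp_eq_lintegral_meas_le_mul ν (f := fun ω => max (Z ω - (ρ + t)) 0)
    (g := fun u => Real.exp (-u)) (.of_forall fun ω => le_max_right _ _)
    ((hZ.sub_const _).max measurable_const).aemeasurable
    (fun u _ => (Real.continuous_exp.comp continuous_neg).intervalIntegrable _ _)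
    (.of_forall fun u => (Real.exp_pos _).le)
  simp only [hint] at h1
  have h2 : ∀ ω, ENNReal.ofReal (1 - Real.exp (ρ + t - Z ω)) =
      ENNReal.ofReal (1 - Real.exp (-max (Z ω - (ρ + t)) 0)) := by
    intro ω
    rcases le_total (Z ω - (ρ + t)) 0 with h | h
    · rw [max_eq_right h, neg_zero, Real.exp_zero, sub_self, ENNReal.ofReal_zero,
        ENNReal.ofReal_eq_zero, sub_nonpos, Real.one_le_exp_iff]
      linarith
    · rw [max_eq_left h, neg_sub]
  simp_rw [h2]
  rw [h1]
  have hb : 0 < 1 / (4 * ρ) := by positivity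
  calc _ ≤ ∫⁻ u in Set.Ioi (0 : ℝ), ENNReal.ofReal
        (Real.exp (-(t ^ 2 / (4 * ρ))) * Real.exp (-(1 / (4 * ρ)) * u ^ 2)) := by
        refine setLIntegral_mono' measurableSet_Ioi fun u (hu : 0 < u) => ?_
        have hset : {ω | u ≤ max (Z ω - (ρ + t)) 0} = {ω | ρ + (u + t) ≤ Z ω} := by
          ext ω
          simp only [Set.mem_ofPred_eq, le_max_iff, not_le.2 hu, or_false]
          constructor <;> intro h <;> linarith
        rw [hset]
        refine (mul_le_mul' (measure_add_le_le_exp hZ hρ hmom (add_nonneg hu.le ht))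
          (ENNReal.ofReal_le_one.2 (Real.exp_le_one_iff.2 (neg_nonpos.2 hu.le)))).trans ?_
        rw [mul_one, ← Real.exp_add]
        refine ENNReal.ofReal_le_ofReal (Real.exp_le_exp.2 ?_)
        have : -(t ^ 2 / (4 * ρ)) + -(1 / (4 * ρ)) * u ^ 2 - -((u + t) ^ 2 / (4 * ρ)) =
            u * t / (2 * ρ) := by field_simp; ring
        have : 0 ≤ u * t / (2 * ρ) := by positivity
        linarith
    _ = _ := by
        rw [← ofReal_integral_eq_lintegral_ofReal
          ((integrable_exp_neg_mul_sq hb).integrableOn.const_mul _)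
          (.of_forall fun u => by positivity), integral_const_mul, integral_gaussian_Ioi]
        have e : Real.pi / (1 / (4 * ρ)) = 2 ^ 2 * (Real.pi * ρ) := by field_simp; ring
        rw [e, Real.sqrt_mul (by norm_num), Real.sqrt_sq (by norm_num)]
        congr 1
        ring

variable {X Q : Type*} [MeasurableSpace X] [MeasurableSpace Q] {n : ℕ}

/-- The square root in `privacyEps` is the `t` for which `t² / (4ρ)` equals the positive part of
`log (√(π ρ) / δ)`. -/
theorem sqrt_mul_exp_le {k n : ℕ} (hk : 0 < k) (hn : 0 < n) {σ δ : ℝ} (hσ : 0 < σ)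
    (hδ : 0 < δ) :
    √(Real.pi * rho k n σ) * Real.exp (-((√(2 * (k / ((n : ℝ) ^ 2 * σ ^ 2)) *
      max (Real.log (√(Real.pi * rho k n σ) / δ)) 0)) ^ 2 / (4 * rho k n σ))) ≤ δ := by
  have hρ := rho_pos hk hn hσ
  have hs : 0 < √(Real.pi * rho k n σ) := by positivity
  have e : 2 * ((k : ℝ) / ((n : ℝ) ^ 2 * σ ^ 2)) = 4 * rho k n σ := by
    unfold rho; field_simp; ring
  rw [e, Real.sq_sqrt (by positivity), mul_div_cancel_left₀ _ (by positivity)]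
  calc _ ≤ √(Real.pi * rho k n σ) *
        Real.exp (-Real.log (√(Real.pi * rho k n σ) / δ)) := by
        gcongr
        exact le_max_left _ _
    _ = δ := by
        rw [Real.exp_neg, Real.exp_log (by positivity)]
        field_simp

/-- The interaction with the Gaussian mechanism is `(ε, δ)`-differentially private. -/
theorem lintegral_interact_gaussianMechanism_le (L : LinearQueryFamily X Q) {k : ℕ} (hk : 0 < k)
    (hn : 0 < n) {σ δ : ℝ} (hσ : 0 < σ) (hδ : 0 < δ) (A : Analyst Q) {S S' : Fin n → X}
    (hS : ∀ q, |L.empirical q S - L.empirical q S'| ≤ 1 / n)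
    {f : Transcript Q k → ENNReal} (hf : Measurable f) (hf1 : ∀ π, f π ≤ 1) :
    ∫⁻ π, f π ∂interact (gaussianMechanism L n σ) A k S ≤
      ENNReal.ofReal (Real.exp (privacyEps k n σ δ)) *
        ∫⁻ π, f π ∂interact (gaussianMechanism L n σ) A k S' + ENNReal.ofReal δ := by
  have hZ := measurable_transcriptLoss (Q := Q) L σ S S' k
  have hρe : (k : ℝ) * ((1 / (n : ℝ)) ^ 2 / (2 * σ ^ 2)) = rho k n σ := by
    unfold rho; field_simp
  have htail := lintegral_one_sub_exp_le hZ (rho_pos hk hn hσ)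
    (ν := interact (gaussianMechanism L n σ) A k S) (fun l hl => by
      rw [← hρe]; exact lintegral_interact_exp_mul_transcriptLoss_le L hσ A S S' hS k hl)
    (Real.sqrt_nonneg (2 * (k / ((n : ℝ) ^ 2 * σ ^ 2)) *
      max (Real.log (√(Real.pi * rho k n σ) / δ)) 0))
  replace htail := htail.trans (ENNReal.ofReal_le_ofReal (sqrt_mul_exp_le hk hn hσ hδ))
  change ∫⁻ π, ENNReal.ofReal (1 - Real.exp (privacyEps k n σ δ - _)) ∂_ ≤ _ at htail
  set ε := privacyEps k n σ δ
  rw [← lintegral_interact_exp_neg_transcriptLoss L hσ A S S' k hf,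
    ← lintegral_const_mul' _ _ ENNReal.ofReal_ne_top]
  refine le_trans ?_ (add_le_add_right htail _)
  rw [← lintegral_add_right _ ((hZ.const_sub ε).exp.const_sub 1).ennreal_ofReal]
  refine lintegral_mono fun π => ?_
  set z := transcriptLoss L σ S S' π
  rw [← mul_assoc, ← ENNReal.ofReal_mul (Real.exp_pos _).le, ← Real.exp_add, ← sub_eq_add_neg]
  -- Split `1` into `exp (ε - z)`, which the change of measure turns into `exp ε` times the law
  -- under `S'`, and the excess, whose integral is at most `δ`.
  have h1 : 1 ≤ ENNReal.ofReal (Real.exp (ε - z)) + ENNReal.ofReal (1 - Real.exp (ε - z)) := by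
    refine le_trans ?_ ENNReal.ofReal_add_le
    simp
  calc f π = 1 * f π := (one_mul _).symm
    _ ≤ (ENNReal.ofReal (Real.exp (ε - z)) + ENNReal.ofReal (1 - Real.exp (ε - z))) * f π := by
        gcongr
    _ ≤ _ := by
        rw [add_mul]
        gcongr
        exact mul_le_of_le_one_right' (hf1 π)

theorem LinearQueryFamily.abs_empirical_sub_update_le (L : LinearQueryFamily X Q) (q : Q)
    (S : Fin n → X) (i : Fin n) (x : X) :
    |L.empirical q S - L.empirical q (Function.update S i x)| ≤ 1 / n := by
  unfold LinearQueryFamily.empirical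
  rw [← mul_sub, ← Finset.sum_sub_distrib, abs_mul, abs_of_nonneg (by positivity)]
  refine mul_le_of_le_one_right (by positivity) ((Finset.abs_sum_le_sum_abs _ _).trans ?_)
  calc _ ≤ ∑ j, if j = i then (1 : ℝ) else 0 := by
        refine Finset.sum_le_sum fun j _ => ?_
        by_cases h : j = i
        · subst h
          have h1 := L.eval_mem q (S j)
          have h2 := L.eval_mem q x
          rw [Function.update_self, if_pos rfl, abs_le]
          constructor <;> linarith [h1.1, h1.2, h2.1, h2.2]
        · simp [h]
    _ = 1 := by simp

end Privacy

/-! ### Exchanging a sample point for a fresh one -/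

section Generalization

variable {X Q : Type*} [MeasurableSpace X] [MeasurableSpace Q] {n : ℕ}

/-- Exchanging one coordinate of an i.i.d. sample with an independent copy. -/
theorem lintegral_pi_update_swap (P : Measure X) [IsProbabilityMeasure P] (i : Fin n)
    {h : (Fin n → X) × X → ENNReal} (hh : Measurable h) :
    ∫⁻ S, ∫⁻ x, h (Function.update S i x, S i) ∂P ∂(Measure.pi fun _ : Fin n => P) =
      ∫⁻ S, ∫⁻ x, h (S, x) ∂P ∂(Measure.pi fun _ : Fin n => P) := by
  obtain ⟨m, rfl⟩ : ∃ m, n = m + 1 := ⟨n - 1, by have := i.pos; omega⟩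
  have hp := (measurePreserving_piFinSuccAbove (fun _ : Fin (m + 1) => P) i).symm
  have hins : Measurable fun p : X × (Fin m → X) => (i.insertNth p.1 p.2 : Fin (m + 1) → X) :=
    (MeasurableEquiv.piFinSuccAbove (fun _ : Fin (m + 1) => X) i).symm.measurable
  have key : ∀ g : (Fin (m + 1) → X) → ENNReal, Measurable g →
      ∫⁻ S, g S ∂(Measure.pi fun _ : Fin (m + 1) => P) =
        ∫⁻ R, ∫⁻ y, g (i.insertNth y R) ∂P ∂(Measure.pi fun _ : Fin m => P) := by
    intro g hg
    rw [← hp.lintegral_comp hg]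
    exact lintegral_prod_symm' _ (hg.comp hins)
  have hu : Measurable fun p : (Fin (m + 1) → X) × X =>
      h (Function.update p.1 i p.2, p.1 i) := by
    refine hh.comp (Measurable.prodMk ?_ (by fun_prop))
    exact measurable_update'.comp (by fun_prop)
  -- With the other coordinates `R` fixed, the two sides differ only in the order of integration
  -- over coordinate `i` and the copy.
  rw [key _ hu.lintegral_prod_right', key _ hh.lintegral_prod_right']
  refine lintegral_congr fun R => ?_
  simp only [Fin.update_insertNth, Fin.insertNth_apply_same]
  rw [lintegral_lintegral_swap]
  have : Measurable fun p : X × X => h (i.insertNth p.2 R, p.1) :=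
    hh.comp ((hins.comp (measurable_snd.prodMk measurable_const)).prodMk measurable_fst)
  exact this.aemeasurable

variable (L : LinearQueryFamily X Q) {k : ℕ}

theorem lintegral_jointLaw (M : Estimator X Q n) (A : Analyst Q) (P : Measure X)
    [IsProbabilityMeasure P] {f : (Fin n → X) × Transcript Q k → ENNReal} (hf : Measurable f) :
    ∫⁻ ω, f ω ∂jointLaw M A P k =
      ∫⁻ S, ∫⁻ π, f (S, π) ∂interact M A k S ∂(Measure.pi fun _ : Fin n => P) :=
  Measure.lintegral_compProd hf

/-- Privacy lets the mechanism run on `S` with `S i` replaced by a fresh `x`. After renaming, the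
point at which `f` is evaluated is independent of the transcript. -/
theorem lintegral_jointLaw_sample_le (hk : 0 < k) {σ δ : ℝ} (hσ : 0 < σ)
    (hδ : 0 < δ) (A : Analyst Q) (P : Measure X) [IsProbabilityMeasure P] (i : Fin n)
    {f : Transcript Q k × X → ENNReal} (hf : Measurable f) (hf1 : ∀ p, f p ≤ 1) :
    ∫⁻ ω, f (ω.2, ω.1 i) ∂jointLaw (gaussianMechanism L n σ) A P k ≤
      ENNReal.ofReal (Real.exp (privacyEps k n σ δ)) *
        ∫⁻ ω, ∫⁻ x, f (ω.2, x) ∂P ∂jointLaw (gaussianMechanism L n σ) A P k +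
        ENNReal.ofReal δ := by
  set κ := interact (gaussianMechanism L n σ) A k
  set c := ENNReal.ofReal (Real.exp (privacyEps k n σ δ))
  rw [lintegral_jointLaw _ _ _ (f := fun ω => f (ω.2, ω.1 i)) (by fun_prop),
    lintegral_jointLaw _ _ _ (f := fun ω => ∫⁻ x, f (ω.2, x) ∂P)
      (hf.lintegral_prod_right'.comp measurable_snd)]
  have hh : Measurable fun p : (Fin n → X) × X => ∫⁻ π, f (π, p.2) ∂κ p.1 :=
    Measurable.lintegral_kernel_prod_right' (κ := κ.comap Prod.fst measurable_fst)
      (f := fun p : ((Fin n → X) × X) × Transcript Q k => f (p.2, p.1.2)) (by fun_prop)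
  calc ∫⁻ S, ∫⁻ π, f (π, S i) ∂κ S ∂(Measure.pi fun _ : Fin n => P)
      = ∫⁻ S, ∫⁻ _, ∫⁻ π, f (π, S i) ∂κ S ∂P ∂(Measure.pi fun _ : Fin n => P) := by simp
    _ ≤ ∫⁻ S, ∫⁻ x, (c * ∫⁻ π, f (π, S i) ∂κ (Function.update S i x) + ENNReal.ofReal δ) ∂P
          ∂(Measure.pi fun _ : Fin n => P) :=
        lintegral_mono fun S => lintegral_mono fun x =>
          lintegral_interact_gaussianMechanism_le L hk i.pos hσ hδ A
            (fun q => L.abs_empirical_sub_update_le q S i x) (by fun_prop) fun _ => hf1 _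
    _ = c * ∫⁻ S, ∫⁻ x, ∫⁻ π, f (π, S i) ∂κ (Function.update S i x) ∂P
          ∂(Measure.pi fun _ : Fin n => P) + ENNReal.ofReal δ := by
        simp only [lintegral_add_right _ measurable_const, lintegral_const, measure_univ, mul_one]
        simp only [c, lintegral_const_mul' _ _ ENNReal.ofReal_ne_top]
    _ = c * ∫⁻ S, ∫⁻ x, ∫⁻ π, f (π, x) ∂κ S ∂P
          ∂(Measure.pi fun _ : Fin n => P) + ENNReal.ofReal δ := by
        rw [lintegral_pi_update_swap P i hh]
    _ = _ := by
        congr 2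
        refine lintegral_congr fun S => ?_
        rw [lintegral_lintegral_swap]
        exact (hf.comp measurable_swap).aemeasurable

instance isProbabilityMeasure_jointLaw (M : Estimator X Q n) (A : Analyst Q) (P : Measure X) [IsProbabilityMeasure P] :
    IsProbabilityMeasure (jointLaw M A P k) := by
  unfold jointLaw; infer_instance

theorem integrable_of_mem_unitInterval {Ω : Type*} [MeasurableSpace Ω] {μ : Measure Ω}
    [IsFiniteMeasure μ] {f : Ω → ℝ} (hf : Measurable f) (h : ∀ ω, f ω ∈ Set.Icc (0 : ℝ) 1) :
    Integrable f μ :=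
  Integrable.of_mem_Icc 0 1 hf.aemeasurable (.of_forall h)

theorem integral_jointLaw_sample_le (hk : 0 < k) {σ δ : ℝ} (hσ : 0 < σ)
    (hδ : 0 < δ) (A : Analyst Q) (P : Measure X) [IsProbabilityMeasure P] (i : Fin n)
    {g : Transcript Q k × X → ℝ} (hg : Measurable g) (hg1 : ∀ p, g p ∈ Set.Icc (0 : ℝ) 1) :
    ∫ ω, g (ω.2, ω.1 i) ∂jointLaw (gaussianMechanism L n σ) A P k ≤
      Real.exp (privacyEps k n σ δ) *
        ∫ ω, ∫ x, g (ω.2, x) ∂P ∂jointLaw (gaussianMechanism L n σ) A P k + δ := by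
  set μ := jointLaw (gaussianMechanism L n σ) A P k
  have hPi : ∀ π, Integrable (fun x => g (π, x)) P := fun π =>
    integrable_of_mem_unitInterval (by fun_prop) fun _ => hg1 _
  have hPm : ∀ π, ∫ x, g (π, x) ∂P ∈ Set.Icc (0 : ℝ) 1 := fun π =>
    ⟨integral_nonneg fun _ => (hg1 _).1, by
      simpa using integral_mono (hPi π) (integrable_const 1) fun x => (hg1 (π, x)).2⟩
  have hPmeas : Measurable fun π => ∫ x, g (π, x) ∂P :=
    hg.stronglyMeasurable.integral_prod_right'.measurable
  have h := lintegral_jointLaw_sample_le L hk hσ hδ A P i hg.ennreal_ofReal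
    fun p => ENNReal.ofReal_le_one.2 (hg1 p).2
  have e : ∀ π, ∫⁻ x, ENNReal.ofReal (g (π, x)) ∂P = ENNReal.ofReal (∫ x, g (π, x) ∂P) :=
    fun π => (ofReal_integral_eq_lintegral_ofReal (hPi π) (.of_forall fun _ => (hg1 _).1)).symm
  simp only [e] at h
  have hI : 0 ≤ ∫ ω, ∫ x, g (ω.2, x) ∂P ∂μ := integral_nonneg fun ω => (hPm ω.2).1
  rw [← ofReal_integral_eq_lintegral_ofReal (integrable_of_mem_unitInterval (by fun_prop)
      fun _ => hg1 _) (.of_forall fun _ => (hg1 _).1),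
    ← ofReal_integral_eq_lintegral_ofReal (f := fun ω : (Fin n → X) × Transcript Q k =>
      ∫ x, g (ω.2, x) ∂P) (integrable_of_mem_unitInterval (hPmeas.comp measurable_snd)
      fun _ => hPm _) (.of_forall fun _ => (hPm _).1),
    ← ENNReal.ofReal_mul (Real.exp_pos _).le, ← ENNReal.ofReal_add (by positivity) hδ.le,
    ENNReal.ofReal_le_ofReal_iff (by positivity)] at h
  exact h

end Generalization

/-! ### From sample accuracy to population accuracy -/

section

variable {X Q : Type*} [MeasurableSpace X] [MeasurableSpace Q] {n : ℕ}

theorem LinearQueryFamily.integrable_eval (L : LinearQueryFamily X Q) (q : Q)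
    (P : Measure X) [IsProbabilityMeasure P] : Integrable (fun x => L.eval q x) P :=
  integrable_of_mem_unitInterval (L.measurable_eval.comp measurable_prodMk_left) (L.eval_mem q)

theorem LinearQueryFamily.integral_eval_mem (L : LinearQueryFamily X Q) (q : Q)
    (P : Measure X) [IsProbabilityMeasure P] : ∫ x, L.eval q x ∂P ∈ Set.Icc (0 : ℝ) 1 :=
  ⟨integral_nonneg fun x => (L.eval_mem q x).1, by
    simpa using integral_mono (L.integrable_eval q P) (integrable_const 1)
      fun x => (L.eval_mem q x).2⟩

theorem LinearQueryFamily.expectation_pi (L : LinearQueryFamily X Q) (hn : 0 < n) (q : Q)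
    (P : Measure X) [IsProbabilityMeasure P] :
    L.expectation q (Measure.pi fun _ : Fin n => P) = ∫ x, L.eval q x ∂P := by
  have hm : Measurable (L.eval q) := L.measurable_eval.comp measurable_prodMk_left
  have hp : ∀ i : Fin n, MeasurePreserving (Function.eval i) (Measure.pi fun _ : Fin n => P) P :=
    fun i => measurePreserving_eval (fun _ : Fin n => P) i
  unfold LinearQueryFamily.expectation LinearQueryFamily.empirical
  rw [integral_const_mul, integral_finsetSum (f := fun (i : Fin n) (S : Fin n → X) =>
    L.eval q (S i)) _ fun i _ => (hp i).integrable_comp_of_integrable (L.integrable_eval q P)]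
  have e : ∀ i : Fin n, ∫ S, L.eval q (S i) ∂(Measure.pi fun _ : Fin n => P) =
      ∫ x, L.eval q x ∂P := fun i => by
    rw [← (hp i).map_eq, integral_map (hp i).measurable.aemeasurable
      hm.aestronglyMeasurable]
    simp [(hp i).map_eq]
  have hn' : (n : ℝ) ≠ 0 := by positivity
  simp only [e, Finset.sum_const, Finset.card_univ, Fintype.card_fin, nsmul_eq_mul]
  field_simp

theorem LinearQueryFamily.empirical_mem (L : LinearQueryFamily X Q) (q : Q) (S : Fin n → X) :
    L.empirical q S ∈ Set.Icc (0 : ℝ) 1 := by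
  unfold LinearQueryFamily.empirical
  have h0 : 0 ≤ ∑ i, L.eval q (S i) := Finset.sum_nonneg fun i _ => (L.eval_mem q (S i)).1
  have h1 : ∑ i, L.eval q (S i) ≤ n := by
    simpa using Finset.sum_le_sum fun i (_ : i ∈ Finset.univ) => (L.eval_mem q (S i)).2
  refine ⟨by positivity, ?_⟩
  rw [one_div_mul_eq_div]
  exact div_le_one_of_le₀ h1 (Nat.cast_nonneg n)

/-- A measurable choice of a coordinate that lies in a given set, if there is one. -/
theorem exists_measurable_select {C : Type*} [MeasurableSpace C] {k : ℕ} (hk : 0 < k) {V : Set C}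
    (hV : MeasurableSet V) :
    ∃ s : (Fin k → C) → C, Measurable s ∧ (∀ π, ∃ j, s π = π j) ∧
      ∀ π, (∃ j, π j ∈ V) → s π ∈ V := by
  classical
  -- The first round in `V` is searched for. The alternative `k ≤ m` in `p` ends the search when
  -- there is none, and then round `0` is returned.
  let c : ℕ → (Fin k → C) → C := fun m π => if h : m < k then π ⟨m, h⟩ else π ⟨0, hk⟩
  let p : ℕ → (Fin k → C) → Prop := fun m π => k ≤ m ∨ c m π ∈ V
  have hc : ∀ m, Measurable (c m) := fun m => by
    by_cases h : m < k <;> simp only [c, h, dite_true, dite_false] <;> fun_prop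
  have hp : ∀ m, MeasurableSet {π | p m π} := fun m =>
    (MeasurableSet.const (k ≤ m)).union (hc m hV)
  have hex : ∀ π, ∃ m, p m π := fun π => ⟨k, Or.inl le_rfl⟩
  refine ⟨fun π => c (Nat.find (hex π)) π, Measurable.find hc hp hex, fun π => ?_, ?_⟩
  · by_cases h : Nat.find (hex π) < k
    · exact ⟨_, dif_pos h⟩
    · exact ⟨_, dif_neg h⟩
  · rintro π ⟨j, hj⟩
    have hpj : p j π := Or.inr (by simpa [c] using hj)
    exact (Nat.find_spec (hex π)).resolve_left
      (not_le.2 ((Nat.find_min' (hex π) hpj).trans_lt j.2))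

/-- The rounds in which the answer misses the empirical value by at least `a`. -/
def sampleError (L : LinearQueryFamily X Q) (n k : ℕ) (a : ℝ) :
    Set ((Fin n → X) × Transcript Q k) :=
  {ω | ∃ j, a ≤ |L.empirical (ω.2 j).1 ω.1 - (ω.2 j).2|}

theorem measurableSet_sampleError (L : LinearQueryFamily X Q) (n k : ℕ) (a : ℝ) :
    MeasurableSet (sampleError L n k a) := by
  unfold sampleError
  rw [Set.ofPred_exists]
  refine MeasurableSet.iUnion fun j => measurableSet_le measurable_const ?_
  have : Measurable fun ω : (Fin n → X) × Transcript Q k => L.empirical (ω.2 j).1 ω.1 :=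
    L.measurable_empirical.comp (f := fun ω : (Fin n → X) × Transcript Q k =>
      ((ω.2 j).1, ω.1)) (by fun_prop)
  fun_prop

theorem jointLaw_sampleError_le (L : LinearQueryFamily X Q) {k : ℕ} {σ : ℝ}
    (hσ : 0 < σ) (A : Analyst Q) (P : Measure X) [IsProbabilityMeasure P] {a : ℝ} (ha : 0 ≤ a) :
    jointLaw (gaussianMechanism L n σ) A P k (sampleError L n k a) ≤
      k * ENNReal.ofReal (erfc (a / (√2 * σ))) := by
  rw [jointLaw, Measure.compProd_apply (measurableSet_sampleError L n k a)]
  calc _ ≤ ∫⁻ _, k * ENNReal.ofReal (erfc (a / (√2 * σ))) ∂(Measure.pi fun _ : Fin n => P) :=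
        lintegral_mono fun S => interact_gaussianMechanism_exists_le L hσ A S ha k
    _ = _ := by simp

/-- The rounds in which the answer misses the population value by at least `a`. -/
def populationError (L : LinearQueryFamily X Q) (n k : ℕ) (P : Measure X) (a : ℝ) :
    Set ((Fin n → X) × Transcript Q k) :=
  {ω | ∃ j, a ≤ |∫ x, L.eval (ω.2 j).1 x ∂P - (ω.2 j).2|}

/-- Sample and population means both lie in `[0, 1]`, so they differ by at most `1`. -/
theorem populationError_subset_sampleError (L : LinearQueryFamily X Q) (k : ℕ)
    (P : Measure X) [IsProbabilityMeasure P] {a b : ℝ} (h : a + 1 ≤ b) :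
    populationError L n k P b ⊆ sampleError L n k a := by
  rintro ⟨S, π⟩ ⟨j, hj⟩
  refine ⟨j, ?_⟩
  have h1 := L.empirical_mem (π j).1 S
  have h2 := L.integral_eval_mem (π j).1 P
  simp only at hj ⊢
  have h3 : |∫ x, L.eval (π j).1 x ∂P - (π j).2| ≤
      |L.empirical (π j).1 S - (π j).2| + |∫ x, L.eval (π j).1 x ∂P - L.empirical (π j).1 S| := by
    refine (abs_sub_le _ (L.empirical (π j).1 S) _).trans_eq (add_comm _ _)
  have h4 : |∫ x, L.eval (π j).1 x ∂P - L.empirical (π j).1 S| ≤ 1 := by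
    rw [abs_le]; constructor <;> linarith [h1.1, h1.2, h2.1, h2.2]
  linarith

/-- If the answers are accurate on the sample up to `a`, then the population error exceeds `a + w`
with a probability that privacy bounds. -/
theorem sub_mul_measureReal_populationError_le (L : LinearQueryFamily X Q) {k : ℕ} (hk : 0 < k)
    (hn : 0 < n) {σ δ : ℝ} (hσ : 0 < σ) (hδ : 0 < δ) (A : Analyst Q) (P : Measure X)
    [IsProbabilityMeasure P] {a w : ℝ} (hw : 0 ≤ w) :
    (w - (Real.exp (privacyEps k n σ δ) - 1)) *
      (jointLaw (gaussianMechanism L n σ) A P k).real (populationError L n k P (a + w)) ≤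
      δ + (1 + w) *
        (jointLaw (gaussianMechanism L n σ) A P k).real (sampleError L n k a) := by
  classical
  set μ := jointLaw (gaussianMechanism L n σ) A P k
  set e := Real.exp (privacyEps k n σ δ)
  have he : 1 ≤ e := Real.one_le_exp ((rho_pos hk hn hσ).le.trans (rho_le_privacyEps k n σ δ))
  set r : Q → ℝ := fun q => ∫ x, L.eval q x ∂P with hr
  have hrm : Measurable r :=
    L.measurable_eval.stronglyMeasurable.integral_prod_right'.measurable
  set V : Set (Q × ℝ) := {c | a + w ≤ |r c.1 - c.2|}
  have hV : MeasurableSet V := measurableSet_le measurable_const (by fun_prop)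
  obtain ⟨s, hs, hsj, hsV⟩ := exists_measurable_select hk hV
  set E : Set ((Fin n → X) × Transcript Q k) := populationError L n k P (a + w) with hE
  have hEiff : ∀ ω, ω ∈ E ↔ s ω.2 ∈ V := fun ω =>
    ⟨fun h => hsV _ h, fun h => by
      obtain ⟨j, hj⟩ := hsj ω.2
      exact ⟨j, by rw [hj] at h; exact h⟩⟩
  have hEm : MeasurableSet E := by
    have : E = (fun ω => s ω.2) ⁻¹' V := Set.ext hEiff
    rw [this]
    exact (hs.comp measurable_snd) hV
  set B := sampleError (X := X) (Q := Q) L n k a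
  have hBm : MeasurableSet B := measurableSet_sampleError L n k a
  -- the selected query or its complement, oriented by the sign of the error
  let φ : Q × ℝ → ℝ → ℝ := fun c y => if c ∈ V then (if c.2 ≤ r c.1 then 1 - y else y) else 0
  have hφ1 : ∀ c y, y ∈ Set.Icc (0 : ℝ) 1 → φ c y ∈ Set.Icc (0 : ℝ) 1 := by
    intro c y hy
    simp only [φ]
    split_ifs
    · exact ⟨by linarith [hy.2], by linarith [hy.1]⟩
    · exact hy
    · simp
  have hφm : ∀ {Ω : Type _} [MeasurableSpace Ω] {c : Ω → Q × ℝ} {y : Ω → ℝ}, Measurable c →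
      Measurable y → Measurable fun ω => φ (c ω) (y ω) := by
    intro Ω _ c y hc hy
    refine Measurable.ite (hc hV) (Measurable.ite ?_ (hy.const_sub 1) hy) measurable_const
    exact measurableSet_le (measurable_snd.comp hc) (hrm.comp (measurable_fst.comp hc))
  let g : Transcript Q k × X → ℝ := fun p => φ (s p.1) (L.eval (s p.1).1 p.2)
  have hg : Measurable g :=
    hφm (hs.comp measurable_fst) (L.measurable_eval.comp
      ((measurable_fst.comp (hs.comp measurable_fst)).prodMk measurable_snd))
  have hg1 : ∀ p, g p ∈ Set.Icc (0 : ℝ) 1 := fun p => hφ1 _ _ (L.eval_mem _ _)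
  have hr1 : ∀ q, r q ∈ Set.Icc (0 : ℝ) 1 := fun q => L.integral_eval_mem q P
  have hgP : ∀ π, ∫ x, g (π, x) ∂P = φ (s π) (r (s π).1) := by
    intro π
    have hI := L.integrable_eval (s π).1 P
    simp only [g, φ]
    split_ifs
    · rw [integral_sub (integrable_const _) hI]; simp [hr]
    · rfl
    · simp
  have hn' : (n : ℝ) ≠ 0 := by positivity
  -- For fixed `c`, `φ c` is affine, or zero, in `y`, so it commutes with averaging over the sample,
  -- as it did with integration over `P`.
  have hgS : ∀ (π : Transcript Q k) (S : Fin n → X),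
      (1 / (n : ℝ)) * ∑ i, g (π, S i) = φ (s π) (L.empirical (s π).1 S) := by
    intro π S
    simp only [g, φ, LinearQueryFamily.empirical]
    split_ifs
    · rw [Finset.sum_sub_distrib, mul_sub]
      simp [hn']
    · rfl
    · simp
  set I := ∫ ω, φ (s ω.2) (r (s ω.2).1) ∂μ with hI
  have hIntS : Integrable (fun ω => φ (s ω.2) (L.empirical (s ω.2).1 ω.1)) μ :=
    integrable_of_mem_unitInterval (hφm (hs.comp measurable_snd)
      (L.measurable_empirical.comp ((measurable_fst.comp (hs.comp measurable_snd)).prodMk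
        measurable_fst))) fun ω => hφ1 _ _ (L.empirical_mem _ _)
  have hIntP : Integrable (fun ω => φ (s ω.2) (r (s ω.2).1)) μ :=
    integrable_of_mem_unitInterval (hφm (hs.comp measurable_snd)
      (hrm.comp (measurable_fst.comp (hs.comp measurable_snd)))) fun ω => hφ1 _ _ (hr1 _)
  have hupper : ∫ ω, φ (s ω.2) (L.empirical (s ω.2).1 ω.1) ∂μ ≤ e * I + δ := by
    have hi : ∀ i : Fin n, ∫ ω, g (ω.2, ω.1 i) ∂μ ≤ e * I + δ := fun i => by
      have := integral_jointLaw_sample_le L hk hσ hδ A P i hg hg1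
      simp only [hgP] at this
      exact this
    simp only [← hgS]
    rw [integral_const_mul, integral_finsetSum _ fun i _ =>
      integrable_of_mem_unitInterval (by fun_prop) fun _ => hg1 _, one_div_mul_eq_div,
      div_le_iff₀ (by positivity)]
    refine (Finset.sum_le_sum fun i _ => hi i).trans_eq ?_
    simp only [Finset.sum_const, Finset.card_univ, Fintype.card_fin, nsmul_eq_mul]
    ring
  have hIE : I ≤ μ.real E := by
    rw [← integral_indicator_one hEm]
    refine integral_mono hIntP ((integrable_const (1 : ℝ)).indicator hEm) fun ω => ?_
    by_cases h : ω ∈ E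
    · rw [Set.indicator_of_mem h]
      exact (hφ1 _ _ (hr1 _)).2
    · rw [Set.indicator_of_notMem h]
      exact (if_neg fun h' => h ((hEiff ω).2 h')).le
  -- Pointwise: on `E` outside `B` the oriented gap is more than `w`; on `E ∩ B` it is at least `-1
  -- = w - (1 + w)`; off `E` it vanishes.
  have hlower : w * μ.real E - (1 + w) * μ.real B ≤
      ∫ ω, φ (s ω.2) (L.empirical (s ω.2).1 ω.1) ∂μ - I := by
    have hE1 : Integrable (E.indicator (1 : (Fin n → X) × Transcript Q k → ℝ)) μ := (integrable_const (1 : ℝ)).indicator hEm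
    have hB1 : Integrable (B.indicator (1 : (Fin n → X) × Transcript Q k → ℝ)) μ := (integrable_const (1 : ℝ)).indicator hBm
    rw [← integral_indicator_one hEm, ← integral_indicator_one hBm, ← integral_const_mul,
      ← integral_const_mul, ← integral_sub (hE1.const_mul _) (hB1.const_mul _), hI,
      ← integral_sub hIntS hIntP]
    refine integral_mono ((hE1.const_mul _).sub (hB1.const_mul _)) (hIntS.sub hIntP) fun ω => ?_
    have h1 := L.empirical_mem (s ω.2).1 ω.1
    have h2 := hr1 (s ω.2).1
    by_cases hωE : ω ∈ E
    · have hsω : s ω.2 ∈ V := (hEiff ω).1 hωE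
      by_cases hωB : ω ∈ B
      · have h3 := hφ1 (s ω.2) _ h1
        have h4 := hφ1 (s ω.2) _ h2
        simp only [Set.indicator_of_mem hωE, Set.indicator_of_mem hωB, Pi.one_apply]
        linarith [h3.1, h4.2]
      · have hlt : |L.empirical (s ω.2).1 ω.1 - (s ω.2).2| < a := by
          obtain ⟨j, hj⟩ := hsj ω.2
          by_contra hcon
          rw [hj] at hcon
          exact hωB ⟨j, not_lt.1 hcon⟩
        have hge : a + w ≤ |r (s ω.2).1 - (s ω.2).2| := hsω
        simp only [Set.indicator_of_mem hωE, Set.indicator_of_notMem hωB, Pi.one_apply, φ,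
          if_pos hsω]
        rw [abs_lt] at hlt
        split_ifs with hsign
        · rw [abs_of_nonneg (sub_nonneg.2 hsign)] at hge
          linarith
        · rw [abs_of_neg (sub_neg.2 (not_le.1 hsign))] at hge
          linarith
    · have hsω : s ω.2 ∉ V := fun h => hωE ((hEiff ω).2 h)
      simp only [Set.indicator_of_notMem hωE, φ, if_neg hsω, mul_zero, sub_self, zero_sub]
      have : (0 : ℝ) ≤ B.indicator 1 ω := Set.indicator_nonneg (fun _ _ => zero_le_one) _
      nlinarith
  -- By `hupper` the expected gap is at most `(e - 1) * I + δ`, and `I ≤ μ.real E` with `e ≥ 1`.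
  nlinarith

theorem distributionallyAccurate_gaussianMechanism (L : LinearQueryFamily X Q) {k : ℕ}
    (hk : 0 < k) (hn : 0 < n) {β σ δ : ℝ} (hβ0 : 0 < β) (hβ1 : β < 1) (hσ : 0 < σ) (hδ : 0 < δ)
    (hδβ : δ ≤ β) :
    DistributionallyAccurate L (gaussianMechanism L n σ) k (objective k n β σ δ) β := by
  intro A P hP
  have hk' : (0 : ℝ) < k := by positivity
  have hk1 : (1 : ℝ) ≤ k := by exact_mod_cast hk
  simp only [L.expectation_pi hn]
  have hy0 : 0 < δ / k := by positivity
  have hy1 : δ / k ≤ 1 := (div_le_one hk').2 (by linarith)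
  set a := √2 * σ * erfcInv (δ / k) with ha
  have ha0 : 0 ≤ a := mul_nonneg (by positivity) (erfcInv_nonneg hy0 hy1)
  set w := Real.exp (privacyEps k n σ δ) - 1 + 6 * (δ / β) with hw
  have hobj : objective k n β σ δ = a + w := by rw [objective, ha, hw]; ring
  have hw0 : 0 ≤ w := by
    have h1 := lt_exp_privacyEps_sub_one hk hn hσ δ
    have h2 := rho_pos hk hn hσ
    have h3 : 0 < δ / β := by positivity
    linarith
  set μ := jointLaw (gaussianMechanism L n σ) A P k with hμ
  have hB : μ (sampleError L n k a) ≤ ENNReal.ofReal δ := by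
    refine (jointLaw_sampleError_le L hσ A P ha0).trans_eq ?_
    have e : a / (√2 * σ) = erfcInv (δ / k) := by rw [ha]; field_simp
    rw [e, erfc_erfcInv hy0 hy1, ← ENNReal.ofReal_natCast, ← ENNReal.ofReal_mul hk'.le]
    congr 1
    field_simp
  rw [hobj]
  change μ (populationError L n k P (a + w)) ≤ ENNReal.ofReal β
  -- If `w ≥ 1`, the sample bound suffices, and this is where `δ ≤ β` enters beyond making `δ / k ≤
  -- 1`. Otherwise `1 + w ≤ 2`, the right side of the stability bound is at most `3δ`, and the
  -- constant `6` leaves a factor of two to spare.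
  by_cases h1 : 1 ≤ w
  · exact (measure_mono (populationError_subset_sampleError L k P (by linarith))).trans
      (hB.trans (ENNReal.ofReal_le_ofReal hδβ))
  have hB' : μ.real (sampleError L n k a) ≤ δ := ENNReal.toReal_le_of_le_ofReal hδ.le hB
  have h := sub_mul_measureReal_populationError_le L hk hn hσ hδ A P (a := a) hw0
  rw [← hμ] at h
  have e : w - (Real.exp (privacyEps k n σ δ) - 1) = 6 * (δ / β) := by rw [hw]; ring
  rw [e] at h
  rw [← ofReal_measureReal]
  refine ENNReal.ofReal_le_ofReal ?_
  set x := μ.real (populationError L n k P (a + w))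
  have h2 : (1 + w) * μ.real (sampleError L n k a) ≤ 2 * δ :=
    mul_le_mul (by linarith) hB' measureReal_nonneg (by norm_num)
  have h3 : 6 * (δ / β) * x ≤ 3 * δ := by linarith
  have h4 : 6 * (δ / β) * x = 6 * δ * (x / β) := by ring
  have h5 : x / β ≤ 1 := by
    rw [h4] at h3
    nlinarith
  rwa [div_le_one hβ0] at h5

end

end AdaptiveData

/-- The minimum `α` of the objective exists, and for every optimal `σ` the Gaussian mechanism
answers `k` adaptively chosen linear queries with `(α, β)`-distributional accuracy. The minimum
is over `σ > 0` and `0 < δ ≤ β`; when it is at most `6`, it is also the minimum over `σ > 0` and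
`0 < δ ≤ k`. -/
theorem mainTheorem9 (k n : ℕ) (hk : 0 < k) (hn : 0 < n) (β : ℝ) (hβ0 : 0 < β) (hβ1 : β < 1)
    {X Q : Type*} [MeasurableSpace X] [MeasurableSpace Q]
    (L : AdaptiveData.LinearQueryFamily X Q) :
    ∃ α : ℝ,
      IsLeast (AdaptiveData.objectiveValues k n β β) α ∧
      (α ≤ 6 → IsLeast (AdaptiveData.objectiveValues k n β k) α) ∧
      ∀ σ δ : ℝ, 0 < σ → 0 < δ → δ ≤ β → AdaptiveData.objective k n β σ δ = α →
        AdaptiveData.DistributionallyAccurate L (AdaptiveData.gaussianMechanism L n σ) k α β := by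
  obtain ⟨α, hα⟩ := AdaptiveData.exists_isLeast_objectiveValues hk hn hβ0 hβ1
  refine ⟨α, hα, AdaptiveData.isLeast_objectiveValues_of_le_six hk hn hβ0 hβ1 hα, ?_⟩
  rintro σ δ hσ hδ hδβ rfl
  exact AdaptiveData.distributionallyAccurate_gaussianMechanism L hk hn hβ0 hβ1 hσ hδ hδβ
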